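/- Let $D=(d_1\ge\dots\ge d_n)$ be a degree sequence of a tree, i.e. there is a finite tree whose vertex degrees, listed in non-increasing order, are $D$. For a finite tree $T$ with root $r$, level $h\ge 0$ consists of the vertices at distance $h$ from $r$, and the leveled degree sequence of $(T,r)$ lists, for each level $h$, the degrees $i_{h,1}\ge i_{h,2}\ge\dots\ge i_{h,k_h}$ of the vertices of that level. Put $c_{0,m}=i_{0,m}$ and $c_{h,m}=i_{h,m}-1$ for $h\ge1$. The rooted tree $(T,r)$ is called level greedy if the vertices of each level $h$ can be labelled $g^h_1,\dots,g^h_{k_h}$ so that $\deg g^h_j=i_{h,j}$ and, for all $h\ge 0$ and $1\le j\le k_h$, the neighbours of $g^h_j$ at level $h+1$ are exactly the $g^{h+1}_l$ with $\sum_{m<j}c_{h,m}<l\le\sum_{m\le j}c_{h,m}$. A tree is called greedy if a root can be chosen such that it is level greedy and every degree occurring at a level is at least as large as every degree occurring at the next level. Then there is a greedy tree $G(D)$ with degree sequence $D$; it is unique up to isomorphism; and every tree $T$ with degree sequence $D$ satisfies $$\rho(T)\le\rho(G(D)),$$ where $\rho$ denotes the spectral radius, i.e. the largest absolute value of an eigenvalue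 of the adjacency matrix. -/

import Mathlib

namespace SimpleGraph

open scoped Classical in
/-- The degree sequence of a finite graph: its vertex degrees, with multiplicity, listed in
non-increasing order. -/
noncomputable def degreeSequence {V : Type*} [Fintype V] (G : SimpleGraph V) : List ℕ :=
  (Finset.univ.val.map fun v => G.degree v).sort (· ≥ ·)

open scoped Classical in
/-- The leveled degree sequence of a finite graph with root `r`: entry `h` is the non-increasing
list of the degrees of the vertices at distance `h` from `r` (levels are counted from `0`; beyond
the height the list is empty). It is meant for connected graphs. -/
noncomputable def leveledDegreeSequence {V : Type*} [Fintype V] (G : SimpleGraph V) (r : V) :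
    ℕ → List ℕ := fun h =>
  ((Finset.univ.filter fun v => G.dist r v = h).val.map fun v => G.degree v).sort (· ≥ ·)

/-- The number of children that the first `j` vertices of level `h` have in total, when the degrees
at the levels are prescribed by `D`. A vertex of degree `d` has `d` children if it is a root
(level `0`) and `d - 1` children otherwise. -/
def childCount (D : ℕ → List ℕ) (h j : ℕ) : ℕ :=
  (((D h).take j).map fun d => if h = 0 then d else d - 1).sum

/-- The level greedy forest with leveled degree sequence `D`. Its vertices are labelled `⟨h, j⟩`,
where `h` is the level and `j` is the position in that level (both counted from `0`). The vertices
of level `h + 1` are handed out to the vertices of level `h` as children from left to right in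
consecutive blocks, whose lengths are the numbers of children prescribed by `D`. -/
def levelGreedyForest (D : ℕ → List ℕ) : SimpleGraph (Σ h : ℕ, Fin (D h).length) where
  Adj x y :=
    (y.1 = x.1 + 1 ∧
      childCount D x.1 x.2 ≤ (y.2 : ℕ) ∧ (y.2 : ℕ) < childCount D x.1 ((x.2 : ℕ) + 1)) ∨
    (x.1 = y.1 + 1 ∧
      childCount D y.1 y.2 ≤ (x.2 : ℕ) ∧ (x.2 : ℕ) < childCount D y.1 ((y.2 : ℕ) + 1))
  symm := ⟨fun _ _ h => h.symm⟩
  loopless := ⟨fun x h => by rcases h with h | h <;> omega⟩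

/-- With root `r`, the tree `G` is a level greedy tree: it is isomorphic, as a rooted graph, to the
level greedy forest with the same leveled degree sequence. -/
def IsLevelGreedyTree {V : Type*} [Fintype V] (G : SimpleGraph V) (r : V) : Prop :=
  G.IsTree ∧ ∃ φ : G ≃g levelGreedyForest (G.leveledDegreeSequence r), (φ r).1 = 0

/-- A greedy tree: for some choice of the root it is a level greedy tree in which every degree
at a level is at least every degree at the next level. -/
def IsGreedyTree {V : Type*} [Fintype V] (G : SimpleGraph V) : Prop :=
  ∃ r : V, G.IsLevelGreedyTree r ∧
    ∀ h : ℕ, ∀ a ∈ G.leveledDegreeSequence r h, ∀ b ∈ G.leveledDegreeSequence r (h + 1), b ≤ a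

open scoped Classical in
/-- The spectral radius of a finite graph: the largest absolute value of an eigenvalue of its
adjacency matrix (which is real symmetric, so that all its eigenvalues are real). -/
noncomputable def adjSpectralRadius {V : Type*} [Fintype V] (G : SimpleGraph V) : ENNReal :=
  spectralRadius ℝ (G.adjMatrix ℝ)

end SimpleGraph

/-! Among the finitely many trees with degree sequence $D$ on a fixed vertex set, let $T$ have the
largest spectral radius $\rho$. The entrywise absolute value $f$ of an extremal eigenvector is a
positive eigenvector for $\rho$. For every competitor $T'$ the matrix $\rho I - A(T')$ is positive
semidefinite, so $f^{\top}A(T')f \le f^{\top}A(T)f$, and equality forces $A(T')f = A(T)f$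
(`exists_maximal_adjSpectralRadius`).

Two surgeries that preserve the degree sequence are tested against $f$. Switching two edges shows
that edges leaving a walk at its two ends are ordered alike by $f$ at both endpoints
(`lt_iff_of_walk`). Moving branches from one vertex to another shows that a larger degree means a
larger value of $f$ (`lt_of_degree_lt`). Rooted at a maximum of $f$, the tree has $f$ decreasing
from level to level, and vertices within a level are ordered like their parents; degrees follow $f$,
so $T$ is greedy.

For uniqueness, the levels of a greedy tree concatenate to $D$, and each level determines the size
of the next. Hence $D$ determines the leveled degree sequence, and with it the tree. The bound for
all trees is then the choice of $T$. -/

namespace SimpleGraph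

open Matrix

/-! ### Spectral radius and extremal eigenvectors -/

section SpectralRadius

open scoped Classical in
/-- A real symmetric matrix whose spectral radius is at most `ρ` has its quadratic form bounded
by `ρ`. -/
theorem posSemidef_smul_one_sub_of_spectralRadius_le {V : Type*} [Fintype V] {A : Matrix V V ℝ}
    (hA : A.IsHermitian) {ρ : NNReal} (h : spectralRadius ℝ A ≤ ρ) :
    ((ρ : ℝ) • (1 : Matrix V V ℝ) - A).PosSemidef := by
  rw [posSemidef_iff_isHermitian_and_spectrum_nonneg]
  refine ⟨?_, ?_⟩
  · refine IsHermitian.sub ?_ hA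
    rw [IsHermitian, conjTranspose_smul, conjTranspose_one, star_trivial]
  · intro k hk
    rw [← Algebra.algebraMap_eq_smul_one, ← spectrum.singleton_sub_eq] at hk
    obtain ⟨l, hl, rfl⟩ := by simpa using hk
    have h1 : (‖l‖₊ : ENNReal) ≤ spectralRadius ℝ A :=
      le_iSup₂ (f := fun (k : ℝ) (_ : k ∈ spectrum ℝ A) => (‖k‖₊ : ENNReal)) l hl
    have h2 : ‖l‖₊ ≤ ρ := by exact_mod_cast h1.trans h
    have h3 : |l| ≤ ρ := by exact_mod_cast h2
    simpa using (le_abs_self l).trans h3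

open scoped Classical in
/-- The spectral radius of a real symmetric matrix is attained at an eigenvector. -/
theorem exists_eigenvector_spectralRadius {V : Type*} [Fintype V] [Nonempty V]
    {A : Matrix V V ℝ} (hA : A.IsHermitian) :
    ∃ (k : ℝ) (x : V → ℝ), x ≠ 0 ∧ A *ᵥ x = k • x ∧ spectralRadius ℝ A = ‖k‖₊ := by
  have hne : (spectrum ℝ A).Nonempty := ⟨_, hA.eigenvalues_mem_spectrum_real (Classical.arbitrary V)⟩
  obtain ⟨k, hk, hmax⟩ := Set.exists_max_image (spectrum ℝ A) (fun k => ‖k‖₊)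
    (Matrix.finite_spectrum A) hne
  have hk' := hk
  rw [← spectrum_toLin', ← Module.End.hasEigenvalue_iff_mem_spectrum] at hk'
  obtain ⟨x, hx⟩ := hk'.exists_hasEigenvector
  refine ⟨k, x, hx.2, by simpa using hx.apply_eq_smul, le_antisymm ?_ ?_⟩
  · exact iSup₂_le fun l hl => by exact_mod_cast hmax l hl
  · exact le_iSup₂ (f := fun (k : ℝ) (_ : k ∈ spectrum ℝ A) => (‖k‖₊ : ENNReal)) k hk

open scoped Classical in
/-- In a connected graph a nonnegative nonzero eigenvector is positive. -/
theorem Connected.pos_of_adjMatrix_mulVec_eq {V : Type*} [Fintype V] {G : SimpleGraph V}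
    (hG : G.Connected) {f : V → ℝ} (hf : ∀ v, 0 ≤ f v) (hf0 : f ≠ 0) {ρ : ℝ}
    (h : G.adjMatrix ℝ *ᵥ f = ρ • f) (v : V) : 0 < f v := by
  refine (hf v).lt_of_ne' fun hv => hf0 ?_
  -- At a zero of `f` the eigenvalue equation makes a sum of nonnegative neighbouring values vanish,
  -- so zeros spread along edges.
  have step : ∀ u w, G.Adj u w → f u = 0 → f w = 0 := by
    intro u w huw hu
    have := congrFun h u
    rw [adjMatrix_mulVec_apply, Pi.smul_apply, hu, smul_zero,
      Finset.sum_eq_zero_iff_of_nonneg fun _ _ => hf _] at this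
    exact this w (by simpa using huw)
  have walk : ∀ u w (p : G.Walk u w), f u = 0 → f w = 0 := by
    intro u w p
    induction p with
    | nil => exact id
    | cons huw _ ih => exact fun hu => ih (step _ _ huw hu)
  funext w
  obtain ⟨p⟩ := hG v w
  exact walk v w p hv

open scoped Classical in
/-- Among the connected graphs of a nonempty class on a fixed vertex set, one with the largest
spectral radius has a positive vector that no graph of the class gives a larger quadratic form;
equality forces the same action on that vector. -/
theorem exists_maximal_adjSpectralRadius {V : Type*} [Fintype V] [Nonempty V]
    (P : SimpleGraph V → Prop) (hP : ∃ T, P T) (hconn : ∀ T, P T → T.Connected) :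
    ∃ T, P T ∧ (∀ T', P T' → T'.adjSpectralRadius ≤ T.adjSpectralRadius) ∧
      ∃ f : V → ℝ, (∀ v, 0 < f v) ∧ ∀ T', P T' →
        f ⬝ᵥ T.adjMatrix ℝ *ᵥ f ≤ f ⬝ᵥ T'.adjMatrix ℝ *ᵥ f →
          T'.adjMatrix ℝ *ᵥ f = T.adjMatrix ℝ *ᵥ f := by
  obtain ⟨T, hT, hmax⟩ := Set.exists_max_image {T | P T} adjSpectralRadius (Set.toFinite _) hP
  refine ⟨T, hT, hmax, ?_⟩
  obtain ⟨k, x, hx0, hx, hk⟩ := exists_eigenvector_spectralRadius (T.isHermitian_adjMatrix ℝ)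
  let f : V → ℝ := fun v => |x v|
  have hpsd : ∀ T', P T' → ((‖k‖₊ : ℝ) • (1 : Matrix V V ℝ) - T'.adjMatrix ℝ).PosSemidef :=
    fun T' hT' => posSemidef_smul_one_sub_of_spectralRadius_le (T'.isHermitian_adjMatrix ℝ)
      (hk ▸ hmax T' hT')
  have hform : ∀ T' : SimpleGraph V,
      star f ⬝ᵥ ((‖k‖₊ : ℝ) • (1 : Matrix V V ℝ) - T'.adjMatrix ℝ) *ᵥ f =
        |k| * (f ⬝ᵥ f) - f ⬝ᵥ T'.adjMatrix ℝ *ᵥ f := by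
    intro T'
    simp [sub_mulVec, dotProduct_sub, smul_mulVec, dotProduct_smul]
  -- Passing to absolute values can only increase the quadratic form, because the adjacency matrix
  -- has nonnegative entries.
  have hkey : |k| * (f ⬝ᵥ f) ≤ f ⬝ᵥ T.adjMatrix ℝ *ᵥ f := by
    have h1 : f ⬝ᵥ f = x ⬝ᵥ x := by simp [f, dotProduct]
    have h2 : |k| * (x ⬝ᵥ x) = |x ⬝ᵥ T.adjMatrix ℝ *ᵥ x| := by
      rw [hx, dotProduct_smul, smul_eq_mul, abs_mul,
        abs_of_nonneg (a := x ⬝ᵥ x) (Finset.sum_nonneg fun i _ => mul_self_nonneg _)]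
    rw [h1, h2]
    refine (Finset.abs_sum_le_sum_abs _ _).trans (Finset.sum_le_sum fun v _ => ?_)
    rw [abs_mul]
    refine mul_le_mul_of_nonneg_left ?_ (abs_nonneg _)
    rw [adjMatrix_mulVec_apply, adjMatrix_mulVec_apply]
    exact Finset.abs_sum_le_sum_abs _ _
  have heig : ∀ T', P T' → f ⬝ᵥ T.adjMatrix ℝ *ᵥ f ≤ f ⬝ᵥ T'.adjMatrix ℝ *ᵥ f →
      T'.adjMatrix ℝ *ᵥ f = |k| • f := by
    intro T' hT' hle
    -- The form of a positive semidefinite matrix vanishes only on its kernel, so equality makes `f`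
    -- an eigenvector of `T'`.
    have h0 := (hpsd T' hT').dotProduct_mulVec_nonneg f
    have h1 := ((hpsd T' hT').dotProduct_mulVec_zero_iff f).1
      (le_antisymm (by rw [hform]; linarith) h0)
    rw [sub_mulVec, sub_eq_zero, smul_mulVec, one_mulVec] at h1
    exact h1.symm
  have hTf := heig T hT le_rfl
  refine ⟨f, (hconn T hT).pos_of_adjMatrix_mulVec_eq (fun v => abs_nonneg _) ?_ hTf, ?_⟩
  · intro h
    exact hx0 (funext fun v => abs_eq_zero.1 (congrFun h v))
  · exact fun T' hT' hle => (heig T' hT' hle).trans hTf.symm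

open scoped Classical in
theorem Iso.adjSpectralRadius_eq {V W : Type*} [Fintype V] [Fintype W] {G : SimpleGraph V}
    {H : SimpleGraph W} (e : G ≃g H) : G.adjSpectralRadius = H.adjSpectralRadius := by
  have h := e.reindex_adjMatrix ℝ
  unfold adjSpectralRadius spectralRadius
  rw [← h, ← AlgEquiv.spectrum_eq (reindexAlgEquiv ℝ ℝ e.toEquiv) (G.adjMatrix ℝ)]
  rfl

open scoped Classical in
theorem Iso.degreeSequence_eq {V W : Type*} [Fintype V] [Fintype W] {G : SimpleGraph V}
    {H : SimpleGraph W} (e : G ≃g H) : G.degreeSequence = H.degreeSequence := by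
  unfold degreeSequence
  congr 1
  rw [← Finset.map_univ_equiv e.toEquiv, Finset.map_val, Multiset.map_map]
  refine Multiset.map_congr rfl fun v _ => ?_
  exact (e.degree_eq v).symm

end SpectralRadius

/-! ### Surgeries on trees: switching edges and shifting branches -/

section TreeOperations

variable {V : Type*}

theorem Connected.of_forall_adj_reachable {G H : SimpleGraph V} (hG : G.Connected)
    (h : ∀ x y, G.Adj x y → H.Reachable x y) : H.Connected := by
  have := hG.nonempty
  refine ⟨fun x y => ?_⟩
  obtain ⟨p⟩ := hG x y
  induction p with
  | nil => exact Reachable.rfl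
  | cons huw _ ih => exact (h _ _ huw).trans ih

open scoped Classical in
theorem sum_degreeSequence [Fintype V] (G : SimpleGraph V) :
    G.degreeSequence.sum = 2 * Nat.card G.edgeSet := by
  have h : (G.degreeSequence : Multiset ℕ) = Finset.univ.val.map fun v => G.degree v :=
    Multiset.sort_eq _ _
  rw [← Multiset.sum_coe, h, Nat.card_eq_fintype_card, ← edgeFinset_card]
  exact G.sum_degrees_eq_twice_card_edges

/-- The degree sequence fixes the number of edges, so after a surgery only connectedness has to be
checked. -/
theorem IsTree.of_connected_of_degreeSequence_eq [Fintype V] {G H : SimpleGraph V} (hG : G.IsTree)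
    (hH : H.Connected) (h : H.degreeSequence = G.degreeSequence) : H.IsTree := by
  rw [isTree_iff_connected_and_card] at hG ⊢
  refine ⟨hH, ?_⟩
  have h1 := sum_degreeSequence G
  have h2 := sum_degreeSequence H
  rw [h] at h2
  have := hG.2
  omega

open scoped Classical in
theorem degreeSequence_eq_of_degree_eq_perm [Fintype V] {G H : SimpleGraph V} (σ : Equiv.Perm V)
    (h : ∀ v, H.degree v = G.degree (σ v)) : H.degreeSequence = G.degreeSequence := by
  unfold degreeSequence
  congr 1
  conv_rhs => rw [← Finset.map_univ_equiv σ, Finset.map_val, Multiset.map_map]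
  exact Multiset.map_congr rfl fun v _ => h v

/-- Replace the edges `a a'` and `b b'` by `a b'` and `a' b`. -/
def switch (G : SimpleGraph V) (a a' b b' : V) : SimpleGraph V :=
  G.deleteEdges {s(a, a'), s(b, b')} ⊔ fromEdgeSet {s(a, b'), s(a', b)}

/-- Replace the edges between `v` and the vertices of `S` by edges between `u` and these vertices. -/
def shift (G : SimpleGraph V) (u v : V) (S : Set V) : SimpleGraph V :=
  G.deleteEdges ((fun w => s(v, w)) '' S) ⊔ fromEdgeSet ((fun w => s(u, w)) '' S)

theorem switch_adj {G : SimpleGraph V} {a a' b b' x y : V} : (G.switch a a' b b').Adj x y ↔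
    G.Adj x y ∧ ¬ ((x = a ∧ y = a' ∨ x = a' ∧ y = a) ∨ (x = b ∧ y = b' ∨ x = b' ∧ y = b)) ∨
      ((x = a ∧ y = b' ∨ x = b' ∧ y = a) ∨ (x = a' ∧ y = b ∨ x = b ∧ y = a')) ∧ x ≠ y := by
  simp only [switch, sup_adj, deleteEdges_adj, fromEdgeSet_adj,
      Set.mem_insert_iff, Set.mem_singleton_iff, Sym2.eq_iff]

theorem shift_adj {G : SimpleGraph V} {u v : V} {S : Set V} {x y : V} :
    (G.shift u v S).Adj x y ↔ G.Adj x y ∧ ¬ (y ∈ S ∧ v = x ∨ x ∈ S ∧ v = y) ∨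
      (y ∈ S ∧ u = x ∨ x ∈ S ∧ u = y) ∧ x ≠ y := by
  have e : ∀ z, (∃ w ∈ S, z = x ∧ w = y ∨ z = y ∧ w = x) ↔
      (y ∈ S ∧ z = x ∨ x ∈ S ∧ z = y) := by grind
  simp only [shift, sup_adj, deleteEdges_adj, fromEdgeSet_adj, Set.mem_image, Sym2.eq_iff, e]

-- The change is computed for an arbitrary vector: the constant vector 1 gives the new degrees, and
-- `f` gives the new quadratic form.
open scoped Classical in
theorem switch_adjMatrix_mulVec [Fintype V] {G : SimpleGraph V} {a a' b b' : V}
    (haa' : G.Adj a a') (hbb' : G.Adj b b') (hab' : ¬ G.Adj a b') (ha'b : ¬ G.Adj a' b)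
    (h1 : a ≠ b) (h2 : a ≠ b') (h3 : a' ≠ b) (h4 : a' ≠ b') (g : V → ℝ) (x : V) :
    ((G.switch a a' b b').adjMatrix ℝ *ᵥ g) x = (G.adjMatrix ℝ *ᵥ g) x +
      ((if x = a then g b' - g a' else 0) + (if x = a' then g b - g a else 0) +
        (if x = b then g a' - g b' else 0) + (if x = b' then g a - g b else 0)) := by
  have key : ∀ y, (G.switch a a' b b').adjMatrix ℝ x y = G.adjMatrix ℝ x y +
      ((if x = a then (if y = b' then 1 else 0) - (if y = a' then 1 else 0) else 0) +
      (if x = a' then (if y = b then 1 else 0) - (if y = a then 1 else 0) else 0) +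
      (if x = b then (if y = a' then 1 else 0) - (if y = b' then 1 else 0) else 0) +
      (if x = b' then (if y = a then 1 else 0) - (if y = b then 1 else 0) else 0)) := by
    intro y
    have h5 := haa'.ne
    have h6 := hbb'.ne
    have haa'' := haa'.symm
    have hbb'' := hbb'.symm
    have hab'' := fun h => hab' (G.symm.symm _ _ h)
    have ha'b' := fun h => ha'b (G.symm.symm _ _ h)
    have hl := G.irrefl (v := x)
    rw [adjMatrix_apply, adjMatrix_apply]
    simp only [switch_adj]
    grind
  simp only [mulVec, dotProduct, key, add_mul, Finset.sum_add_distrib]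
  split_ifs <;> simp [sub_mul, Finset.sum_sub_distrib]

open scoped Classical in
theorem shift_adjMatrix_mulVec [Fintype V] {G : SimpleGraph V} {u v : V} {S : Finset V}
    (hS : ∀ w ∈ S, G.Adj v w) (hSu : ∀ w ∈ S, ¬ G.Adj u w) (huS : u ∉ S) (huv : u ≠ v)
    (g : V → ℝ) (x : V) :
    ((G.shift u v S).adjMatrix ℝ *ᵥ g) x = (G.adjMatrix ℝ *ᵥ g) x +
      ((if x = u then ∑ w ∈ S, g w else 0) - (if x = v then ∑ w ∈ S, g w else 0) +
        (if x ∈ S then g u - g v else 0)) := by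
  have key : ∀ y, (G.shift u v S).adjMatrix ℝ x y = G.adjMatrix ℝ x y +
      ((if x = u then (if y ∈ S then 1 else 0) else 0) -
      (if x = v then (if y ∈ S then 1 else 0) else 0) +
      (if x ∈ S then (if y = u then 1 else 0) - (if y = v then 1 else 0) else 0)) := by
    intro y
    have hl := G.irrefl (v := v)
    have hvS : v ∉ S := fun h => hl (hS v h)
    have hS' := fun w hw => G.symm.symm _ _ (hS w hw)
    have hSu' := fun w hw h => hSu w hw (G.symm.symm _ _ h)
    rw [adjMatrix_apply, adjMatrix_apply]
    simp only [shift_adj, Finset.mem_coe]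
    grind
  simp only [mulVec, dotProduct, key, add_mul, sub_mul, Finset.sum_add_distrib,
    Finset.sum_sub_distrib]
  congr 2
  · split_ifs <;> simp
  · split_ifs <;> simp [sub_mul, Finset.sum_sub_distrib]

end TreeOperations

/-! ### How the extremal vector orders edges and degrees -/

section RayleighMaximal

variable {V : Type*} {T : SimpleGraph V} {f : V → ℝ}

/-- Such an edge would close a cycle with a path from `a` to `b` extended by `b'`. -/
theorem IsAcyclic.not_adj_of_walk {a b b' : V} (hT : T.IsAcyclic) (hab : a ≠ b)
    (hbb' : T.Adj b b') (p : T.Walk a b) (hb' : b' ∉ p.support) : ¬ T.Adj a b' := by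
  classical
  intro h
  have hp : (p.bypass.concat hbb').IsPath :=
    p.bypass_isPath.concat (fun h => hb' (p.support_bypass_subset_support h)) hbb'
  have := hT.eq_penultimate_of_adj_end hp h.symm (Walk.start_mem_support _)
  rw [Walk.penultimate_concat] at this
  exact hab this

/-- The walk contains neither removed edge, so `a` and `b` stay joined; `a'` is then reattached at
`b` and `b'` at `a`. -/
theorem Connected.switch {a a' b b' : V} (hT : T.Connected) (haa' : T.Adj a a')
    (hbb' : T.Adj b b') (p : T.Walk a b) (ha' : a' ∉ p.support) (hb' : b' ∉ p.support) :
    (T.switch a a' b b').Connected := by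
  have hp : ∀ e ∈ p.edges, e ∈ (T.switch a a' b b').edgeSet := by
    intro e he
    induction e with | _ x y
    have hx := p.fst_mem_support_of_mem_edges he
    have hy := p.snd_mem_support_of_mem_edges he
    rw [mem_edgeSet, switch_adj]
    refine Or.inl ⟨p.adj_of_mem_edges he, ?_⟩
    grind
  have hab : (T.switch a a' b b').Reachable a b := ⟨p.transfer _ hp⟩
  have ha := p.start_mem_support
  have hb := p.end_mem_support
  have h1 : (T.switch a a' b b').Adj a b' := switch_adj.2 (by grind)
  have h2 : (T.switch a a' b b').Adj a' b := switch_adj.2 (by grind)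
  have h3 : (T.switch a a' b b').Reachable a a' := hab.trans h2.reachable.symm
  have h4 : (T.switch a a' b b').Reachable b b' := hab.symm.trans h1.reachable
  refine hT.of_forall_adj_reachable fun x y hxy => ?_
  by_cases h : (x = a ∧ y = a' ∨ x = a' ∧ y = a) ∨ (x = b ∧ y = b' ∨ x = b' ∧ y = b)
  · rcases h with (⟨rfl, rfl⟩ | ⟨rfl, rfl⟩) | (⟨rfl, rfl⟩ | ⟨rfl, rfl⟩)
    exacts [h3, h3.symm, h4, h4.symm]
  · exact Adj.reachable (switch_adj.2 (Or.inl ⟨hxy, h⟩))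

variable [Fintype V]

open scoped Classical in
/-- No tree with the degree sequence of the tree `T` gives the positive vector `f` a larger
quadratic form than `T`, and those that give it the same one act on it like `T`. -/
structure IsRayleighMaximal (T : SimpleGraph V) (f : V → ℝ) : Prop where
  isTree : T.IsTree
  pos : ∀ v, 0 < f v
  mulVec_eq : ∀ T' : SimpleGraph V, T'.IsTree → T'.degreeSequence = T.degreeSequence →
    f ⬝ᵥ T.adjMatrix ℝ *ᵥ f ≤ f ⬝ᵥ T'.adjMatrix ℝ *ᵥ f →
      T'.adjMatrix ℝ *ᵥ f = T.adjMatrix ℝ *ᵥ f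

open scoped Classical in
theorem natCast_degree_eq_mulVec (G : SimpleGraph V) (v : V) :
    (G.degree v : ℝ) = (G.adjMatrix ℝ *ᵥ fun _ => 1) v := by
  rw [adjMatrix_mulVec_apply]
  simp

namespace IsRayleighMaximal

variable (h : IsRayleighMaximal T f)
include h

/-- Switching changes the quadratic form by $2(f(b)-f(a))(f(a')-f(b'))\ge 0$. Maximality then forces
the same action on `f`, and comparing it at `a` and `a'` gives the two equalities. -/
theorem eq_of_walk {a a' b b' : V} (hab : a ≠ b)
    (haa' : T.Adj a a') (hbb' : T.Adj b b') (p : T.Walk a b) (ha' : a' ∉ p.support)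
    (hb' : b' ∉ p.support) (hle : f a ≤ f b) (hle' : f b' ≤ f a') :
    f a = f b ∧ f a' = f b' := by
  classical
  have hacy := h.isTree.isAcyclic
  have n1 : ¬ T.Adj a b' := hacy.not_adj_of_walk hab hbb' p hb'
  have n2 : ¬ T.Adj a' b := fun hadj =>
    hacy.not_adj_of_walk hab.symm haa' p.reverse (by simpa using ha') hadj.symm
  have e1 : a ≠ b' := fun e => hb' (e ▸ p.start_mem_support)
  have e2 : a' ≠ b := fun e => ha' (e ▸ p.end_mem_support)
  have e3 : a' ≠ b' := fun e => n2 (e ▸ hbb'.symm)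
  have hmul := switch_adjMatrix_mulVec haa' hbb' n1 n2 hab e1 e2 e3
  have hdeg : (T.switch a a' b b').degreeSequence = T.degreeSequence := by
    refine degreeSequence_eq_of_degree_eq_perm (Equiv.refl V) fun v => ?_
    have : ((T.switch a a' b b').degree v : ℝ) = T.degree v := by
      rw [natCast_degree_eq_mulVec, natCast_degree_eq_mulVec, hmul]
      simp
    exact_mod_cast this
  have htree := h.isTree.of_connected_of_degreeSequence_eq
    (h.isTree.connected.switch haa' hbb' p ha' hb') hdeg
  have hform : f ⬝ᵥ (T.switch a a' b b').adjMatrix ℝ *ᵥ f =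
      f ⬝ᵥ T.adjMatrix ℝ *ᵥ f + 2 * ((f b - f a) * (f a' - f b')) := by
    simp only [dotProduct, hmul, mul_add, Finset.sum_add_distrib, mul_ite, mul_zero,
      Finset.sum_ite_eq', Finset.mem_univ, if_true]
    ring
  have heq := h.mulVec_eq _ htree hdeg (by
    rw [hform]
    nlinarith [mul_nonneg (sub_nonneg.2 hle) (sub_nonneg.2 hle')])
  have h1 := congrFun heq a
  have h2 := congrFun heq a'
  rw [hmul] at h1 h2
  simp only [haa'.ne, haa'.ne.symm, hab, e1, e2, e3, if_true, if_false] at h1 h2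
  constructor <;> linarith

theorem lt_iff_of_walk {a a' b b' : V} (hab : a ≠ b)
    (haa' : T.Adj a a') (hbb' : T.Adj b b') (p : T.Walk a b) (ha' : a' ∉ p.support)
    (hb' : b' ∉ p.support) : f a < f b ↔ f a' < f b' := by
  constructor
  · intro hlt
    by_contra hc
    exact hlt.ne (h.eq_of_walk hab haa' hbb' p ha' hb' hlt.le (not_lt.1 hc)).1
  · intro hlt
    by_contra hc
    exact hlt.ne (h.eq_of_walk hab.symm hbb' haa' p.reverse (by simpa using hb')
      (by simpa using ha') (not_lt.1 hc) hlt.le).2.symm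

-- Otherwise, moving $\deg v-\deg u$ branches from `v` to `u` exchanges the two degrees without
-- decreasing the quadratic form, yet raises the value of $Af$ at `u` by a positive sum.
open scoped Classical in
theorem lt_of_degree_lt {u v : V} (hd : T.degree u < T.degree v) : f u < f v := by
  have huv : u ≠ v := by
    rintro rfl
    exact lt_irrefl _ hd
  by_contra hc
  have hle : f v ≤ f u := not_lt.1 hc
  have hacy := h.isTree.isAcyclic
  obtain ⟨p, hp⟩ := h.isTree.connected.exists_isPath v u
  cases p with
  | nil => exact huv rfl
  | @cons _ t _ hvt q =>
  rw [Walk.cons_isPath_iff] at hp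
  have hdu : 0 < T.degree u := by
    have : Nontrivial V := ⟨u, v, huv⟩
    exact h.isTree.connected.preconnected.degree_pos_of_nontrivial u
  -- The neighbour `t` of `v` towards `u` must stay, to keep the tree connected; enough others
  -- remain because $\deg u\ge 1$.
  obtain ⟨S, hSsub, hScard⟩ := Finset.exists_subset_card_eq
    (s := (T.neighborFinset v).erase t) (n := T.degree v - T.degree u) (by
      rw [Finset.card_erase_of_mem (by simpa using hvt), card_neighborFinset_eq_degree]
      omega)
  have hS : ∀ w ∈ S, T.Adj v w := fun w hw => by
    simpa using (Finset.mem_erase.1 (hSsub hw)).2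
  have hSt : ∀ w ∈ S, w ≠ t := fun w hw => (Finset.mem_erase.1 (hSsub hw)).1
  have hpath : (Walk.cons hvt q).IsPath := by rw [Walk.cons_isPath_iff]; exact hp
  have hSq : ∀ w ∈ S, w ∉ q.support := fun w hw hwq => by
    refine hSt w hw ?_
    simpa using hacy.eq_snd_of_adj_start hpath (hS w hw) (by simp [hwq])
  have huS : u ∉ S := fun hu => hSq u hu q.end_mem_support
  have hSu : ∀ w ∈ S, ¬ T.Adj u w := fun w hw huw =>
    hacy.not_adj_of_walk huv (hS w hw) (Walk.cons hvt q).reverse (by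
      simpa using ⟨hSq w hw, hSt w hw, (hS w hw).ne'⟩) huw
  have hmul := shift_adjMatrix_mulVec hS hSu huS huv
  have hvS : v ∉ S := fun hv => (hS v hv).ne rfl
  have hdeg : (T.shift u v S).degreeSequence = T.degreeSequence := by
    refine degreeSequence_eq_of_degree_eq_perm (Equiv.swap u v) fun x => ?_
    have hcast : ((T.degree v - T.degree u : ℕ) : ℝ) = T.degree v - T.degree u :=
      Nat.cast_sub hd.le
    have : ((T.shift u v S).degree x : ℝ) = T.degree (Equiv.swap u v x) := by
      rw [natCast_degree_eq_mulVec, hmul, ← natCast_degree_eq_mulVec]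
      rw [Finset.sum_const, hScard, nsmul_one, hcast]
      rcases eq_or_ne x u with rfl | hxu
      · rw [Equiv.swap_apply_left]
        simp [huv]
      rcases eq_or_ne x v with rfl | hxv
      · rw [Equiv.swap_apply_right]
        simp [huv.symm]
      · rw [Equiv.swap_apply_of_ne_of_ne hxu hxv]
        simp [hxu, hxv]
    exact_mod_cast this
  have hconn : (T.shift u v S).Connected := by
    have hvu : (T.shift u v S).Reachable v u := by
      refine ⟨(Walk.cons hvt q).transfer _ fun e he => ?_⟩
      induction e with | _ x y
      have hadj := (Walk.cons hvt q).adj_of_mem_edges he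
      rw [mem_edgeSet, shift_adj]
      refine Or.inl ⟨hadj, ?_⟩
      have hx := (Walk.cons hvt q).fst_mem_support_of_mem_edges he
      have hy := (Walk.cons hvt q).snd_mem_support_of_mem_edges he
      simp only [Walk.support_cons, List.mem_cons] at hx hy
      rintro (⟨hyS, rfl⟩ | ⟨hxS, rfl⟩)
      · rcases hy with rfl | hy
        · exact hvS hyS
        · exact hSq _ hyS hy
      · rcases hx with rfl | hx
        · exact hvS hxS
        · exact hSq _ hxS hx
    have huw : ∀ w ∈ S, (T.shift u v S).Adj u w := fun w hw =>
      shift_adj.2 (Or.inr ⟨Or.inl ⟨hw, rfl⟩, fun e => huS (e ▸ hw)⟩)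
    refine h.isTree.connected.of_forall_adj_reachable fun x y hxy => ?_
    by_cases hc : y ∈ S ∧ v = x ∨ x ∈ S ∧ v = y
    · rcases hc with ⟨hy, rfl⟩ | ⟨hx, rfl⟩
      · exact hvu.trans (huw y hy).reachable
      · exact (hvu.trans (huw x hx).reachable).symm
    · exact Adj.reachable (shift_adj.2 (Or.inl ⟨hxy, hc⟩))
  have hform : f ⬝ᵥ (T.shift u v S).adjMatrix ℝ *ᵥ f =
      f ⬝ᵥ T.adjMatrix ℝ *ᵥ f + 2 * ((f u - f v) * ∑ w ∈ S, f w) := by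
    simp only [dotProduct, hmul, mul_add, mul_sub, Finset.sum_add_distrib, Finset.sum_sub_distrib,
      mul_ite, mul_zero, Finset.sum_ite_eq', Finset.mem_univ, if_true, Finset.sum_ite_mem,
      Finset.univ_inter, ← Finset.sum_mul]
    ring
  have hpos : 0 < ∑ w ∈ S, f w := Finset.sum_pos (fun w _ => h.pos w)
    (Finset.card_pos.1 (by omega))
  have heq := h.mulVec_eq _ (h.isTree.of_connected_of_degreeSequence_eq hconn hdeg) hdeg (by
    rw [hform]
    nlinarith [mul_nonneg (sub_nonneg.2 hle) hpos.le])
  have h1 := congrFun heq u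
  rw [hmul] at h1
  simp only [if_true, huv, if_false, huS] at h1
  linarith

end IsRayleighMaximal

end RayleighMaximal

/-! ### Parents, ancestors and monotonicity from level to level -/

section RootedTree

variable {V : Type*} {T : SimpleGraph V}

theorem Connected.exists_geodesic (hT : T.Connected) (a b : V) :
    ∃ p : T.Walk a b, ∀ w ∈ p.support, T.dist a w + T.dist w b = T.dist a b := by
  classical
  obtain ⟨p, hp⟩ := hT.exists_walk_length_eq_dist a b
  refine ⟨p, fun w hw => le_antisymm ?_ hT.dist_triangle⟩
  have h1 := dist_le (p.takeUntil w hw)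
  have h2 := dist_le (p.dropUntil w hw)
  have h3 := congrArg Walk.length (p.take_spec hw)
  rw [Walk.length_append] at h3
  omega

theorem Connected.exists_parent (hT : T.Connected) {r v : V} (hv : v ≠ r) :
    ∃ p, T.Adj v p ∧ T.dist r v = T.dist r p + 1 := by
  obtain ⟨p, hp⟩ := hT.exists_walk_length_eq_dist v r
  cases p with
  | nil => exact absurd rfl hv
  | @cons _ w _ hvw q =>
    refine ⟨w, hvw, ?_⟩
    have h1 := dist_le q
    have h2 := hT.dist_triangle (u := v) (v := w) (w := r)
    rw [Walk.length_cons] at hp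
    rw [dist_eq_one_iff_adj.2 hvw] at h2
    rw [dist_comm, dist_comm (u := r)]
    omega

/-- The parents of `x` and `y` are joined by a walk that avoids `x` and `y`, unless `x` is an
ancestor of `y`. -/
theorem Connected.exists_walk_of_parents (hT : T.Connected) {r x y x' y' : V}
    (hy : T.Adj y y') (hx' : T.dist r x = T.dist r x' + 1)
    (hy' : T.dist r y = T.dist r y' + 1) (hle : T.dist r x ≤ T.dist r y)
    (hxy : T.dist r x + T.dist x y ≠ T.dist r y) :
    ∃ p : T.Walk x' y', x ∉ p.support ∧ y ∉ p.support := by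
  -- The walk climbs from `x'` to the root and descends to `y'`. Levels keep it away from `x` and
  -- `y`, except that the descent could meet `x`, which would make `x` an ancestor of `y`.
  obtain ⟨p, hp⟩ := hT.exists_geodesic x' r
  obtain ⟨q, hq⟩ := hT.exists_geodesic r y'
  refine ⟨p.append q, ?_, ?_⟩ <;> rw [Walk.mem_support_append_iff]
  · rintro (hw | hw)
    · have := hp _ hw
      rw [dist_comm (u := x), dist_comm (u := x') (v := r)] at this
      omega
    · have h1 := hq _ hw
      have h2 := hT.dist_triangle (u := x) (v := y') (w := y)
      have h3 := hT.dist_triangle (u := r) (v := x) (w := y)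
      rw [dist_eq_one_iff_adj.2 hy.symm] at h2
      omega
  · rintro (hw | hw)
    · have := hp _ hw
      rw [dist_comm (u := y), dist_comm (u := x') (v := r)] at this
      omega
    · have := hq _ hw
      omega

/-- Two parents would be joined through the root by a walk avoiding `v`, which would close a cycle.
-/
theorem IsTree.parent_unique (hT : T.IsTree) {r v p q : V} (hp : T.Adj v p) (hq : T.Adj v q)
    (hp' : T.dist r v = T.dist r p + 1) (hq' : T.dist r v = T.dist r q + 1) : p = q := by
  by_contra hpq
  obtain ⟨s, hs⟩ := hT.connected.exists_geodesic p r
  obtain ⟨t, ht⟩ := hT.connected.exists_geodesic r q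
  refine hT.isAcyclic.not_adj_of_walk hpq hq.symm (s.append t) ?_ hp.symm
  rw [Walk.mem_support_append_iff]
  rintro (hw | hw)
  · have := hs _ hw
    rw [dist_comm (u := v), dist_comm (u := p) (v := r)] at this
    omega
  · have := ht _ hw
    omega

/-- An ancestor `a` of `b` is joined to `b` by a walk within the levels from that of `a` to that of
`b`. -/
theorem Connected.exists_walk_of_ancestor (hT : T.Connected) {r a b : V}
    (hab : T.dist r a + T.dist a b = T.dist r b) :
    ∃ p : T.Walk a b, ∀ w ∈ p.support, T.dist r a ≤ T.dist r w ∧ T.dist r w ≤ T.dist r b := by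
  obtain ⟨p, hp⟩ := hT.exists_geodesic a b
  refine ⟨p, fun w hw => ?_⟩
  have h1 := hp _ hw
  have h2 := hT.dist_triangle (u := r) (v := w) (w := b)
  have h3 := hT.dist_triangle (u := r) (v := a) (w := w)
  omega

theorem IsTree.exists_child [Fintype V] [DecidableRel T.Adj] (hT : T.IsTree) {r v : V}
    (hv : 1 < T.degree v) : ∃ w, T.Adj v w ∧ T.dist r w = T.dist r v + 1 := by
  rw [← card_neighborFinset_eq_degree, Finset.one_lt_card] at hv
  obtain ⟨x, hx, y, hy, hxy⟩ := hv
  rw [mem_neighborFinset] at hx hy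
  rcases hT.dist_eq_dist_add_one_of_adj r hx with h1 | h1
  · rcases hT.dist_eq_dist_add_one_of_adj r hy with h2 | h2
    · exact absurd (hT.parent_unique hx hy h1 h2) hxy
    · exact ⟨y, hy, h2⟩
  · exact ⟨x, hx, h1⟩

namespace IsRayleighMaximal

variable [Fintype V] {f : V → ℝ} (h : IsRayleighMaximal T f) {r : V} (hr : ∀ v, f v ≤ f r)
include h

open scoped Classical in
theorem degree_le {a b : V} (hab : f b ≤ f a) : T.degree b ≤ T.degree a := by
  by_contra hc
  exact (h.lt_of_degree_lt (not_le.1 hc)).not_ge hab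

-- By induction on the level of `a`: a violation at `a`, `b` is passed by an edge switch to a pair
-- whose upper member is the parent of `a`.
include hr in
theorem le_of_dist_lt {a b : V} (hab : T.dist r a < T.dist r b) : f b ≤ f a := by
  classical
  have hconn := h.isTree.connected
  induction hn : T.dist r a generalizing a b with
  | zero =>
    rw [hconn.dist_eq_zero_iff] at hn
    exact hn ▸ hr b
  | succ n ih =>
    by_contra hlt
    rw [not_le] at hlt
    have har : a ≠ r := by
      rintro rfl
      simp at hn
    obtain ⟨a', haa', ha'⟩ := hconn.exists_parent har
    -- If `a` is an ancestor of `b`, the walk between them avoids the parent of `a` and a child of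
    -- `b`. That child exists since `a` has a parent and a child, and $\deg b\ge\deg a$. Otherwise
    -- both parents are used.
    by_cases hanc : T.dist r a + T.dist a b = T.dist r b
    · obtain ⟨p, hp⟩ := hconn.exists_walk_of_ancestor hanc
      have hne : a ≠ b := by
        rintro rfl
        exact hab.ne rfl
      obtain ⟨c, hac, hc⟩ : ∃ c, T.Adj a c ∧ T.dist r c = T.dist r a + 1 := by
        cases p with
        | nil => exact absurd rfl hne
        | @cons _ c _ hac q =>
          refine ⟨c, hac, ?_⟩
          have := (hp c (by simp)).1
          rcases h.isTree.dist_eq_dist_add_one_of_adj r hac with h1 | h1 <;> omega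
      have hdeg : 1 < T.degree b := by
        refine lt_of_lt_of_le ?_ (h.degree_le hlt.le)
        rw [← card_neighborFinset_eq_degree, Finset.one_lt_card]
        refine ⟨a', by simpa using haa', c, by simpa using hac, ?_⟩
        rintro rfl
        omega
      obtain ⟨b', hbb', hb'⟩ := h.isTree.exists_child (r := r) hdeg
      have h1 := (h.lt_iff_of_walk hne haa' hbb' p
        (fun hw => by have := hp _ hw; omega) (fun hw => by have := hp _ hw; omega)).1 hlt
      exact h1.not_ge (ih (by omega) (by omega))
    · have hbr : b ≠ r := by
        rintro rfl
        simp at hab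
      obtain ⟨b', hbb', hb'⟩ := hconn.exists_parent hbr
      obtain ⟨p, hpa, hpb⟩ := hconn.exists_walk_of_parents hbb' ha' hb' hab.le hanc
      have hne : a' ≠ b' := by
        rintro rfl
        omega
      have h1 := (h.lt_iff_of_walk hne haa'.symm hbb'.symm p hpa hpb).2 hlt
      exact h1.not_ge (ih (by omega) (by omega))

/-- Vertices of the same level with different parents are ordered like their parents. -/
theorem lt_iff_parent_lt {x y x' y' : V} (hx : T.Adj x x') (hy : T.Adj y y')
    (hx' : T.dist r x = T.dist r x' + 1) (hy' : T.dist r y = T.dist r y' + 1)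
    (hxy : T.dist r x = T.dist r y) (hne : x' ≠ y') : f x' < f y' ↔ f x < f y := by
  have hconn := h.isTree.connected
  obtain ⟨p, hpa, hpb⟩ := hconn.exists_walk_of_parents hy hx' hy' hxy.le (fun hd => by
    have : T.dist x y = 0 := by omega
    rw [hconn.dist_eq_zero_iff] at this
    subst this
    exact hne (h.isTree.parent_unique hx hy hx' hy'))
  exact h.lt_iff_of_walk hne hx.symm hy.symm p hpa hpb

end IsRayleighMaximal

end RootedTree

/-! ### Ordered levels and the level greedy labelling -/

section Levels

variable {V : Type*} {T : SimpleGraph V} {r : V} {c : V → List V}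

/-- `c v` enumerates the children of `v` in the tree `T` with root `r`. -/
structure IsChildEnumeration (T : SimpleGraph V) (r : V) (c : V → List V) : Prop where
  nodup : ∀ v, (c v).Nodup
  mem_iff : ∀ v w, w ∈ c v ↔ T.Adj v w ∧ T.dist r w = T.dist r v + 1

/-- The levels of a rooted tree, the children of each vertex being listed in a prescribed order. -/
def levelList (r : V) (c : V → List V) : ℕ → List V
  | 0 => [r]
  | h + 1 => (levelList r c h).flatMap c

namespace IsChildEnumeration

variable (hc : IsChildEnumeration T r c)
include hc

theorem mem_levelList (hT : T.Connected) {h : ℕ} {v : V} :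
    v ∈ levelList r c h ↔ T.dist r v = h := by
  induction h generalizing v with
  | zero => simp [levelList, hT.dist_eq_zero_iff, eq_comm]
  | succ h ih =>
    simp only [levelList, List.mem_flatMap, ih, hc.mem_iff]
    constructor
    · rintro ⟨p, hp, -, hv⟩
      omega
    · intro hv
      have hvr : v ≠ r := by
        rintro rfl
        simp at hv
      obtain ⟨p, hp, hd⟩ := hT.exists_parent hvr
      exact ⟨p, by omega, hp.symm, hd⟩

theorem nodup_levelList (hT : T.IsTree) (h : ℕ) : (levelList r c h).Nodup := by
  induction h with
  | zero => simp [levelList]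
  | succ h ih =>
    rw [levelList, List.nodup_flatMap]
    refine ⟨fun v _ => hc.nodup v, ih.imp ?_⟩
    intro p q hpq w hp hq
    rw [hc.mem_iff] at hp hq
    exact hpq (hT.parent_unique hp.1.symm hq.1.symm hp.2 hq.2)

open scoped Classical in
theorem length_eq [Fintype V] (hT : T.IsTree) (v : V) :
    (c v).length = if T.dist r v = 0 then T.degree v else T.degree v - 1 := by
  have h1 : (c v).toFinset = (T.neighborFinset v).filter fun w => T.dist r w = T.dist r v + 1 := by
    ext w
    simp [hc.mem_iff]
  rw [← List.toFinset_card_of_nodup (hc.nodup v), h1]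
  split_ifs with h0
  · rw [Finset.filter_true_of_mem, card_neighborFinset_eq_degree]
    intro w hw
    rw [mem_neighborFinset] at hw
    rcases hT.dist_eq_dist_add_one_of_adj r hw with h | h <;> omega
  · obtain ⟨p, hp, hd⟩ := hT.connected.exists_parent (r := r) (v := v) (by
      rintro rfl
      simp at h0)
    have h2 : ((T.neighborFinset v).filter fun w => T.dist r w = T.dist r v + 1) =
        (T.neighborFinset v).erase p := by
      ext w
      simp only [Finset.mem_filter, Finset.mem_erase, mem_neighborFinset]
      constructor
      · rintro ⟨hw, hw'⟩
        refine ⟨?_, hw⟩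
        rintro rfl
        omega
      · rintro ⟨hwp, hw⟩
        refine ⟨hw, ?_⟩
        rcases hT.dist_eq_dist_add_one_of_adj r hw with h | h
        · exact absurd (hT.parent_unique hw hp h hd) hwp
        · exact h
    rw [h2, Finset.card_erase_of_mem (by simpa using hp), card_neighborFinset_eq_degree]

open scoped Classical in
theorem leveledDegreeSequence_perm [Fintype V] (hT : T.IsTree) (h : ℕ) :
    (T.leveledDegreeSequence r h).Perm ((levelList r c h).map fun v => T.degree v) := by
  rw [← Multiset.coe_eq_coe, leveledDegreeSequence, Multiset.sort_eq, ← Multiset.map_coe]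
  congr 1
  rw [Multiset.Nodup.ext (Finset.nodup _) (Multiset.coe_nodup.2 (hc.nodup_levelList hT h))]
  intro v
  rw [Multiset.mem_coe, hc.mem_levelList hT.connected]
  simp

theorem length_levelList [Fintype V] (hT : T.IsTree) (h : ℕ) :
    (levelList r c h).length = (T.leveledDegreeSequence r h).length := by
  simpa using (hc.leveledDegreeSequence_perm hT h).length_eq.symm

open scoped Classical in
theorem map_length_eq [Fintype V] (hT : T.IsTree) (h : ℕ) :
    ((levelList r c h).map c).map List.length =
      ((levelList r c h).map fun v => T.degree v).map fun d => if h = 0 then d else d - 1 := by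
  rw [List.map_map, List.map_map]
  refine List.map_congr_left fun v hv => ?_
  rw [hc.mem_levelList hT.connected] at hv
  simp [hc.length_eq hT, hv]

theorem length_leveledDegreeSequence_succ [Fintype V] (hT : T.IsTree) (h : ℕ) :
    (T.leveledDegreeSequence r (h + 1)).length =
      childCount (T.leveledDegreeSequence r) h (T.leveledDegreeSequence r h).length := by
  classical
  rw [← hc.length_levelList hT, levelList, List.length_flatMap, childCount, List.take_length]
  have h1 := congrArg List.sum (hc.map_length_eq hT h)
  rw [List.map_map] at h1
  refine Eq.trans h1 ?_
  exact ((hc.leveledDegreeSequence_perm hT h).map _).sum_eq.symm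

end IsChildEnumeration

theorem _root_.List.Nodup.getElem_mem_drop_take {α : Type*} {l : List α} (hl : l.Nodup)
    {a b i : ℕ} (hi : i < l.length) : l[i] ∈ (l.take b).drop a ↔ a ≤ i ∧ i < b := by
  rw [List.mem_iff_getElem]
  constructor
  · rintro ⟨j, hj, e⟩
    rw [List.getElem_drop, List.getElem_take, hl.getElem_inj_iff] at e
    simp only [List.length_drop, List.length_take] at hj
    omega
  · rintro ⟨h1, h2⟩
    refine ⟨i - a, ?_, ?_⟩
    · simp only [List.length_drop, List.length_take]
      omega
    · rw [List.getElem_drop, List.getElem_take, hl.getElem_inj_iff]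
      omega

open scoped Classical in
/-- If the degrees decrease along the levels of a rooted tree, for some way of listing the children
of the vertices, then the tree is level greedy. -/
theorem IsChildEnumeration.isLevelGreedyTree [Fintype V] (hc : IsChildEnumeration T r c)
    (hT : T.IsTree)
    (hsorted : ∀ h, ((levelList r c h).map fun v => T.degree v).Pairwise (· ≥ ·)) :
    T.IsLevelGreedyTree r := by
  -- Both lists are sorted and are permutations of each other, so positions in `levelList` serve as
  -- the greedy labels.
  have hL : ∀ h, T.leveledDegreeSequence r h = (levelList r c h).map fun v => T.degree v :=
    fun h => (hc.leveledDegreeSequence_perm hT h).eq_of_pairwise' (r := (· ≥ ·))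
      (Multiset.pairwise_sort _ _) (hsorted h)
  have hlen : ∀ h (j : Fin (T.leveledDegreeSequence r h).length),
      (j : ℕ) < (levelList r c h).length := fun h j => by
    rw [hc.length_levelList hT]
    exact j.2
  let ψ : (Σ h : ℕ, Fin (T.leveledDegreeSequence r h).length) → V :=
    fun x => (levelList r c x.1)[(x.2 : ℕ)]'(hlen x.1 x.2)
  have hdist : ∀ x, T.dist r (ψ x) = x.1 := fun x =>
    (hc.mem_levelList hT.connected).1 (List.getElem_mem _)
  have hcount : ∀ h j, (((((levelList r c h).map c).map List.length).take j).sum) =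
      childCount (T.leveledDegreeSequence r) h j := fun h j => by
    rw [hc.map_length_eq hT, childCount, hL, List.map_take]
  -- Level `h + 1` is the concatenation of the child lists, so the children of one vertex form the
  -- block between two consecutive partial sums.
  have hblock : ∀ h j (hj : j < (levelList r c h).length),
      ((levelList r c (h + 1)).take (childCount (T.leveledDegreeSequence r) h (j + 1))).drop
        (childCount (T.leveledDegreeSequence r) h j) = c (levelList r c h)[j] := by
    intro h j hj
    rw [← hcount, ← hcount, levelList, List.flatMap_def,
      List.drop_take_succ_flatten_eq_getElem _ _ (by simpa using hj), List.getElem_map]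
  have key : ∀ x y : Σ h : ℕ, Fin (T.leveledDegreeSequence r h).length,
      (y.1 = x.1 + 1 ∧ childCount (T.leveledDegreeSequence r) x.1 x.2 ≤ (y.2 : ℕ) ∧
        (y.2 : ℕ) < childCount (T.leveledDegreeSequence r) x.1 ((x.2 : ℕ) + 1)) ↔
      ψ y ∈ c (ψ x) := by
    rintro ⟨h, j⟩ ⟨h', l⟩
    by_cases hh : h' = h + 1
    · subst hh
      rw [← hblock h j (hlen h j),
        (hc.nodup_levelList hT (h + 1)).getElem_mem_drop_take (hlen (h + 1) l)]
      simp
    · refine iff_of_false (fun h => hh h.1) fun hmem => hh ?_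
      have := ((hc.mem_iff _ _).1 hmem).2
      rwa [hdist, hdist] at this
  have hinj : Function.Injective ψ := by
    rintro ⟨h, j⟩ ⟨h', l⟩ e
    have hh : h = h' := by
      have := congrArg (T.dist r) e
      rwa [hdist, hdist] at this
    subst hh
    have hjl : j = l := Fin.ext (((hc.nodup_levelList hT h).getElem_inj_iff).1 e)
    rw [hjl]
  have hsurj : Function.Surjective ψ := by
    intro v
    obtain ⟨j, hj, e⟩ := List.mem_iff_getElem.1
      ((hc.mem_levelList hT.connected (v := v)).2 rfl)
    exact ⟨⟨T.dist r v, ⟨j, by rwa [← hc.length_levelList hT]⟩⟩, e⟩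
  let φ : levelGreedyForest (T.leveledDegreeSequence r) ≃g T :=
    { toEquiv := Equiv.ofBijective ψ ⟨hinj, hsurj⟩
      map_rel_iff' := by
        intro x y
        change T.Adj (ψ x) (ψ y) ↔ _ ∨ _
        rw [key x y, key y x, hc.mem_iff, hc.mem_iff]
        constructor
        · intro hadj
          rcases hT.dist_eq_dist_add_one_of_adj r hadj with h | h
          · exact Or.inr ⟨hadj.symm, h⟩
          · exact Or.inl ⟨hadj, h⟩
        · rintro (h | h)
          exacts [h.1, h.1.symm] }
  refine ⟨hT, φ.symm, ?_⟩
  have h1 : ψ (φ.symm r) = r := φ.apply_symm_apply r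
  rw [← hdist, h1, dist_self]

open scoped Classical in
theorem exists_isChildEnumeration [Fintype V] (T : SimpleGraph V) (r : V) (f : V → ℝ) :
    ∃ c, IsChildEnumeration T r c ∧ ∀ v, (c v).Pairwise fun x y => f y ≤ f x := by
  let R : V → V → Prop := fun x y => f y ≤ f x
  have : IsTrans V R := ⟨fun _ _ _ h1 h2 => le_trans h2 h1⟩
  have : Std.Total R := ⟨fun x y => le_total (f y) (f x)⟩
  refine ⟨fun v => (Finset.univ.filter fun w =>
    T.Adj v w ∧ T.dist r w = T.dist r v + 1).toList.insertionSort R, ⟨fun v => ?_, fun v w => ?_⟩,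
    fun v => List.pairwise_insertionSort R _⟩
  · exact (List.perm_insertionSort R _).nodup_iff.2 (Finset.nodup_toList _)
  · simp [(List.perm_insertionSort R _).mem_iff]

/-- Siblings are sorted by the choice of `c`; vertices with different parents inherit the order of
the parents. -/
theorem IsRayleighMaximal.pairwise_levelList [Fintype V] {f : V → ℝ} (h : IsRayleighMaximal T f)
    (hc : IsChildEnumeration T r c) (hf : ∀ v, (c v).Pairwise fun x y => f y ≤ f x) (n : ℕ) :
    (levelList r c n).Pairwise fun x y => f y ≤ f x := by
  induction n with
  | zero => simp [levelList]
  | succ n ih =>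
    rw [levelList, List.pairwise_flatMap]
    refine ⟨fun v _ => hf v, ?_⟩
    refine ((ih.and (hc.nodup_levelList h.isTree n)).imp_of_mem ?_)
    rintro p q hp hq ⟨hpq, hne⟩ x hx y hy
    rw [hc.mem_levelList h.isTree.connected] at hp hq
    rw [hc.mem_iff] at hx hy
    by_contra hlt
    rw [not_le] at hlt
    exact ((h.lt_iff_parent_lt hx.1.symm hy.1.symm hx.2 hy.2 (by omega) hne).2 hlt).not_ge hpq

theorem IsRayleighMaximal.isGreedyTree [Fintype V] {f : V → ℝ} (h : IsRayleighMaximal T f) :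
    T.IsGreedyTree := by
  classical
  have := h.isTree.connected.nonempty
  obtain ⟨r, hr⟩ := Finite.exists_max f
  obtain ⟨c, hc, hf⟩ := exists_isChildEnumeration T r f
  refine ⟨r, hc.isLevelGreedyTree h.isTree fun n => ?_, ?_⟩
  · rw [List.pairwise_map]
    exact (h.pairwise_levelList hc hf n).imp fun hxy => h.degree_le hxy
  · intro n a ha b hb
    rw [(hc.leveledDegreeSequence_perm h.isTree _).mem_iff, List.mem_map] at ha hb
    obtain ⟨x, hx, rfl⟩ := ha
    obtain ⟨y, hy, rfl⟩ := hb
    rw [hc.mem_levelList h.isTree.connected] at hx hy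
    exact h.degree_le (h.le_of_dist_lt hr (by omega))

end Levels

/-! ### The degree sequence determines the greedy tree -/

section Uniqueness

theorem childCount_congr {L L' : ℕ → List ℕ} {h : ℕ} (e : L h = L' h) (j : ℕ) :
    childCount L h j = childCount L' h j := by
  rw [childCount, childCount, e]

/-- If the number of entries of each level is prescribed by the previous level, then the levels are
determined by their concatenation. -/
theorem eq_of_flatMap_range_eq {L L' : ℕ → List ℕ} (h0 : (L 0).length = (L' 0).length)
    (hL : ∀ h, (L (h + 1)).length = childCount L h (L h).length)
    (hL' : ∀ h, (L' (h + 1)).length = childCount L' h (L' h).length) {D : List ℕ} {N N' : ℕ}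
    (hN : ∀ M ≥ N, (List.range M).flatMap L = D) (hN' : ∀ M ≥ N', (List.range M).flatMap L' = D) :
    L = L' := by
  have hprefix : ∀ (K : ℕ → List ℕ) (m M : ℕ), m ≤ M →
      (List.range m).flatMap K <+: (List.range M).flatMap K := by
    intro K m M hmM
    obtain ⟨k, rfl⟩ := Nat.exists_eq_add_of_le hmM
    rw [List.range_add, List.flatMap_append]
    exact List.prefix_append _ _
  have key : ∀ h, ∀ g < h, L g = L' g := by
    intro h
    induction h with
    | zero => exact fun g hg => absurd hg (Nat.not_lt_zero g)
    | succ h ih =>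
      have hlen : (L h).length = (L' h).length := by
        cases h with
        | zero => exact h0
        | succ k => rw [hL, hL', ← ih k k.lt_succ_self, childCount_congr (ih k k.lt_succ_self)]
      have hflat : (List.range h).flatMap L = (List.range h).flatMap L' := by
        rw [List.flatMap_def, List.flatMap_def,
          List.map_congr_left fun g hg => ih g (List.mem_range.1 hg)]
      have e1 : ∀ K : ℕ → List ℕ, (List.range (h + 1)).flatMap K =
          (List.range h).flatMap K ++ K h := fun K => by
        rw [List.range_succ, List.flatMap_append, List.flatMap_singleton]
      -- Taking at least `N` levels yields all of `D`, so the first `h + 1` levels of either family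
      -- form a prefix of `D`. The prefixes have equal length and hence agree.
      have p1 := hprefix L (h + 1) (max N (h + 1)) (le_max_right _ _)
      have p2 := hprefix L' (h + 1) (max N' (h + 1)) (le_max_right _ _)
      rw [hN _ (le_max_left _ _), e1] at p1
      rw [hN' _ (le_max_left _ _), e1, ← hflat] at p2
      have e2 : (List.range h).flatMap L ++ L h = (List.range h).flatMap L ++ L' h :=
        (List.prefix_of_prefix_length_le p1 p2 (by simp [hlen])).eq_of_length (by simp [hlen])
      intro g hg
      rcases Nat.lt_succ_iff_lt_or_eq.1 hg with hg | rfl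
      · exact ih g hg
      · exact List.append_cancel_left e2
  exact funext fun h => key (h + 1) h h.lt_succ_self

variable {V : Type*} [Fintype V] {T : SimpleGraph V} {r : V}

theorem IsTree.length_leveledDegreeSequence_zero (hT : T.IsTree) (r : V) :
    (T.leveledDegreeSequence r 0).length = 1 := by
  -- Any order of the children will do, so the sorting key is the zero function.
  obtain ⟨c, hc, -⟩ := exists_isChildEnumeration T r 0
  rw [← hc.length_levelList hT]
  rfl

theorem IsTree.length_leveledDegreeSequence_succ (hT : T.IsTree) (r : V) (h : ℕ) :
    (T.leveledDegreeSequence r (h + 1)).length =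
      childCount (T.leveledDegreeSequence r) h (T.leveledDegreeSequence r h).length := by
  obtain ⟨c, hc, -⟩ := exists_isChildEnumeration T r 0
  exact hc.length_leveledDegreeSequence_succ hT h

theorem IsTree.le_of_mem_leveledDegreeSequence (hT : T.IsTree)
    (hr : ∀ h : ℕ, ∀ a ∈ T.leveledDegreeSequence r h, ∀ b ∈ T.leveledDegreeSequence r (h + 1), b ≤ a)
    {g h : ℕ} (hgh : g < h) {a b : ℕ} (ha : a ∈ T.leveledDegreeSequence r g)
    (hb : b ∈ T.leveledDegreeSequence r h) : b ≤ a := by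
  induction h, hgh using Nat.le_induction generalizing b with
  | base => exact hr g a ha b hb
  | succ h hgh ih =>
    -- The chain of comparisons needs an entry at every intermediate level; an empty level would
    -- make the next one empty too.
    obtain ⟨d, hd⟩ : ∃ d, d ∈ T.leveledDegreeSequence r h := by
      by_contra hne
      have hnil : T.leveledDegreeSequence r h = [] := List.eq_nil_iff_forall_not_mem.2
        fun d hd => hne ⟨d, hd⟩
      have := hT.length_leveledDegreeSequence_succ r h
      rw [hnil, childCount, hnil] at this
      simp only [List.take_nil, List.map_nil, List.sum_nil, List.length_eq_zero_iff] at this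
      simp [this] at hb
    exact (hr h d hd b hb).trans (ih hd)

open scoped Classical in
/-- The degree sequence is the concatenation of the levels if the degrees decrease from one level to
the next. -/
theorem IsTree.exists_flatMap_range_leveledDegreeSequence (hT : T.IsTree)
    (hr : ∀ h : ℕ, ∀ a ∈ T.leveledDegreeSequence r h,
      ∀ b ∈ T.leveledDegreeSequence r (h + 1), b ≤ a) :
    ∃ N, ∀ M ≥ N, (List.range M).flatMap (T.leveledDegreeSequence r) = T.degreeSequence := by
  obtain ⟨c, hc, -⟩ := exists_isChildEnumeration T r 0
  -- The bound is the height plus one, since levels are counted from 0.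
  refine ⟨(Finset.univ.sup fun v => T.dist r v) + 1, fun M hM => ?_⟩
  refine List.Perm.eq_of_pairwise' (r := (· ≥ ·)) ?_ (Multiset.pairwise_sort _ _) ?_
  · rw [List.pairwise_flatMap]
    exact ⟨fun h _ => Multiset.pairwise_sort _ _, List.pairwise_lt_range.imp fun hgh a ha b hb =>
      hT.le_of_mem_leveledDegreeSequence hr hgh ha hb⟩
  · have h1 : ((List.range M).flatMap (T.leveledDegreeSequence r)).Perm
        (((List.range M).flatMap (levelList r c)).map fun v => T.degree v) := by
      rw [List.map_flatMap]
      exact List.Perm.flatMap_left _ fun h _ => hc.leveledDegreeSequence_perm hT h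
    refine h1.trans ?_
    rw [← Multiset.coe_eq_coe, degreeSequence, Multiset.sort_eq, ← Multiset.map_coe]
    congr 1
    have hnodup : ((List.range M).flatMap (levelList r c)).Nodup := by
      rw [List.nodup_flatMap]
      refine ⟨fun h _ => hc.nodup_levelList hT h, List.pairwise_lt_range.imp ?_⟩
      intro g h hgh v hv hv'
      rw [hc.mem_levelList hT.connected] at hv hv'
      omega
    rw [Multiset.Nodup.ext (Multiset.coe_nodup.2 hnodup) (Finset.nodup _)]
    intro v
    have hv : T.dist r v ≤ Finset.univ.sup fun v => T.dist r v :=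
      Finset.le_sup (f := fun v => T.dist r v) (Finset.mem_univ v)
    simp only [Multiset.mem_coe, List.mem_flatMap, List.mem_range,
      hc.mem_levelList hT.connected, Finset.mem_val, Finset.mem_univ, iff_true]
    exact ⟨_, by omega, rfl⟩

/-- Greedy trees with the same degree sequence are isomorphic. -/
theorem IsGreedyTree.nonempty_iso {W : Type*} [Fintype W] {S : SimpleGraph W}
    (hT : T.IsGreedyTree) (hS : S.IsGreedyTree) (h : T.degreeSequence = S.degreeSequence) :
    Nonempty (T ≃g S) := by
  obtain ⟨r, ⟨hT, φ, -⟩, hr⟩ := hT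
  obtain ⟨s, ⟨hS, χ, -⟩, hs⟩ := hS
  obtain ⟨N, hN⟩ := hT.exists_flatMap_range_leveledDegreeSequence hr
  obtain ⟨N', hN'⟩ := hS.exists_flatMap_range_leveledDegreeSequence hs
  have e : T.leveledDegreeSequence r = S.leveledDegreeSequence s := by
    refine eq_of_flatMap_range_eq ?_ (hT.length_leveledDegreeSequence_succ r)
      (hS.length_leveledDegreeSequence_succ s) (h ▸ hN) hN'
    rw [hT.length_leveledDegreeSequence_zero, hS.length_leveledDegreeSequence_zero]
  rw [e] at φ
  exact ⟨φ.trans χ.symm⟩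

/-- A graph with degree sequence `D` has a copy on the vertex set `Fin D.length`. -/
theorem exists_iso_fin_of_degreeSequence_eq {D : List ℕ} (h : T.degreeSequence = D) :
    ∃ S : SimpleGraph (Fin D.length), Nonempty (T ≃g S) := by
  classical
  have hcard : Fintype.card V = D.length := by
    rw [← h, degreeSequence, Multiset.length_sort, Multiset.card_map]
    rfl
  exact ⟨_, ⟨Iso.map (Fintype.equivFinOfCardEq hcard) T⟩⟩

end Uniqueness

end SimpleGraph

theorem mainTheorem7 (D : List ℕ)
    (hD : ∃ (n : ℕ) (T : SimpleGraph (Fin n)), T.IsTree ∧ T.degreeSequence = D) :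
    ∃ G : SimpleGraph (Fin D.length),
      (G.IsGreedyTree ∧ G.degreeSequence = D) ∧
      (∀ (V : Type*) [Fintype V] (G' : SimpleGraph V),
        G'.IsGreedyTree → G'.degreeSequence = D → Nonempty (G' ≃g G)) ∧
      (∀ (V : Type*) [Fintype V] (T : SimpleGraph V),
        T.IsTree → T.degreeSequence = D → T.adjSpectralRadius ≤ G.adjSpectralRadius) := by
  obtain ⟨n, T₀, hT₀, hD₀⟩ := hD
  -- All trees are transported to one vertex set, where there are only finitely many graphs to
  -- maximize over.
  obtain ⟨S₀, ⟨e₀⟩⟩ := SimpleGraph.exists_iso_fin_of_degreeSequence_eq hD₀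
  have hS₀ := e₀.isTree_iff.1 hT₀
  have := hS₀.connected.nonempty
  obtain ⟨G, ⟨hG, hGD⟩, hmax, f, hf, hfG⟩ := SimpleGraph.exists_maximal_adjSpectralRadius
    (fun T : SimpleGraph (Fin D.length) => T.IsTree ∧ T.degreeSequence = D)
    ⟨S₀, hS₀, e₀.degreeSequence_eq.symm.trans hD₀⟩ fun T hT => hT.1.connected
  have hgreedy : G.IsGreedyTree := SimpleGraph.IsRayleighMaximal.isGreedyTree
    ⟨hG, hf, fun T' hT' hT'D => hfG T' ⟨hT', hT'D.trans hGD⟩⟩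
  refine ⟨G, ⟨hgreedy, hGD⟩, fun V _ G' hG' hG'D => ?_, fun V _ T hT hTD => ?_⟩
  · exact hG'.nonempty_iso hgreedy (hG'D.trans hGD.symm)
  · obtain ⟨S, ⟨e⟩⟩ := SimpleGraph.exists_iso_fin_of_degreeSequence_eq hTD
    rw [e.adjSpectralRadius_eq]
    exact hmax S ⟨e.isTree_iff.1 hT, e.degreeSequence_eq.symm.trans hTD⟩
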